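/- Let $\mathcal X$ be a Polish space with its Borel $\sigma$-algebra, $P$ a Markov transition kernel on $\mathcal X$ and $\pi$ a probability measure with $\pi P=\pi$. Write $\pi(g)=\int g\,d\pi$ and $PV(x)=\int V(y)\,P(x,dy)$. Minorization. Let $J\subseteq\mathcal X$ be a Borel set with $\pi(J)>0$, let $\beta>0$, and let $\nu$ be a probability measure such that $P(x,\cdot)\ge\beta\,\nu(\cdot)$ for all $x\in J$ (so $\beta\le1$). Drift. Let $V:\mathcal X\to[1,\infty)$ be Borel, $0\le\lambda<1$ and $K<\infty$, with $PV(x)\le\lambda V(x)$ for $x\notin J$ and $PV(x)\le K$ for $x\in J$. Split chain. Let $(X_n,\Gamma_n)_{n\ge0}$ be the Markov chain on $\mathcal X\times\{0,1\}$ with $X_0\sim\nu$ and $\Pr(\Gamma_n=1\mid X_n=x)=\beta\mathbf 1(x\in J)$, where $X_{n+1}$ given $(X_n,\Gamma_n)=(x,\gamma)$ has law $\nu$ if $\gamma=1$, and law $Q(x,\cdot)=\dfrac{P(x,\cdot)-\beta\mathbf 1(x\in J)\nu(\cdot)}{1-\beta\mathbf 1(x\in J)}$ if $\gamma=0$ (if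 $\beta=1$ and $x\in J$, then $\gamma=1$ almost surely and $Q(x,\cdot)$ is irrelevant). Let $\tau_1=\min\{n\ge1:\Gamma_{n-1}=1\}$ be the first regeneration time, and let $\Xi_1(g)=\sum_{i=0}^{\tau_1-1}g(X_i)$. Put $$n_0=\frac{\mathbb E\,\tau_1^2}{\mathbb E\,\tau_1}-1,\qquad \sigma^2_{\rm as}(f)=\frac{\mathbb E\,(\Xi_1(\bar f))^2}{\mathbb E\,\tau_1},\qquad \bar f=f-\pi(f).$$ Theorem. In this setting $\pi(V)<\infty$, $\mathbb E\,\tau_1<\infty$, and: (i) $$n_0\le2\left[\frac{\lambda\pi(V)-\lambda}{1-\lambda}+\frac{K-\lambda}{\beta(1-\lambda)}-1\right].$$ (ii) If moreover $f:\mathcal X\to\mathbb R$ is Borel with $\pi(|f|)<\infty$ and $|\bar f(x)|\le V(x)$ for all $x$, then $$\sigma^2_{\rm as}(f)\le\frac{1+\lambda}{1-\lambda}\,\pi(V^2)+2\left[\frac{K-\lambda-\beta}{\beta(1-\lambda)}\right]\pi(V),$$ where the right-hand side is $+\infty$ if $\pi(V^2)=\infty$. -/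

import Mathlib

open MeasureTheory ProbabilityTheory
open scoped ENNReal

namespace RegenSim

/-- The small set condition: `J` is a measurable set of positive `π`-measure, `β > 0`, and
`P(x, ·) ≥ β 1(x ∈ J) ν(·)` as measures. -/
structure SmallSet {S : Type*} [MeasurableSpace S] (P : Kernel S S) (π : Measure S)
    (J : Set S) (β : ℝ) (ν : Measure S) : Prop where
  measurableSet : MeasurableSet J
  pos_measure : 0 < π J
  pos : 0 < β
  minor : ∀ x ∈ J, ENNReal.ofReal β • ν ≤ P x

/-- The drift condition on `V`: `PV ≤ λ V` off `J` and `PV ≤ K` on `J`, where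
`PV(x) = ∫ V(y) P(x, dy)` is the integral, with values in `[0, ∞]`, of a positive function. -/
structure Drift {S : Type*} [MeasurableSpace S] (P : Kernel S S) (J : Set S) (V : S → ℝ)
    (lam K : ℝ) : Prop where
  off : ∀ x ∉ J, ∫⁻ y, ENNReal.ofReal (V y) ∂(P x) ≤ ENNReal.ofReal (lam * V x)
  on : ∀ x ∈ J, ∫⁻ y, ENNReal.ofReal (V y) ∂(P x) ≤ ENNReal.ofReal K

section Split

variable {S : Type*} [MeasurableSpace S] {P : Kernel S S} [IsMarkovKernel P] {π : Measure S}
  {J : Set S} {β : ℝ} {ν : Measure S} [IsProbabilityMeasure ν]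

/-- The conditional law of the regeneration indicator `Γ` given the state:
`Pr(Γ = 1 | X = x) = β 1(x ∈ J)`. -/
noncomputable def indicator (h : SmallSet P π J β ν) : Kernel S Bool :=
  open Classical in
  Kernel.piecewise h.measurableSet
    (Kernel.const S (ENNReal.ofReal β • Measure.dirac true
      + ENNReal.ofReal (1 - β) • Measure.dirac false))
    (Kernel.const S (Measure.dirac false))

/-- The residual kernel `Q(x, ·) = (P(x, ·) - β 1(x ∈ J) ν) / (1 - β 1(x ∈ J))`.
If `β = 1` and `x ∈ J` this is `0 / 0`; the value is then irrelevant, because `Γ = 1` almost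
surely in such a state, and it is set to `ν`. -/
noncomputable def residual (h : SmallSet P π J β ν) : Kernel S S where
  toFun x :=
    open Classical in
    if x ∈ J then
      if β = 1 then ν else (ENNReal.ofReal (1 - β))⁻¹ • (P x - ENNReal.ofReal β • ν)
    else P x
  measurable' := by
    classical
    refine Measure.measurable_of_measurable_coe _ fun A hA => ?_
    have h1 : ∀ x, (if x ∈ J then
        if β = 1 then ν else (ENNReal.ofReal (1 - β))⁻¹ • (P x - ENNReal.ofReal β • ν)
        else P x) A = if x ∈ J then
        (if β = 1 then ν A else (ENNReal.ofReal (1 - β))⁻¹ * (P x A - ENNReal.ofReal β * ν A))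
        else P x A := by
      intro x
      split_ifs with hx hb
      · rfl
      · have hfin : IsFiniteMeasure (ENNReal.ofReal β • ν) :=
          ν.smul_finite ENNReal.ofReal_ne_top
        rw [Measure.smul_apply, Measure.sub_apply hA (h.minor x hx), Measure.smul_apply,
          smul_eq_mul, smul_eq_mul]
      · rfl
    simp_rw [h1]
    refine Measurable.ite h.measurableSet ?_ (P.measurable_coe hA)
    split_ifs
    · exact measurable_const
    · exact ((P.measurable_coe hA).sub_const _).const_mul _

theorem SmallSet.le_one (h : SmallSet P π J β ν) : β ≤ 1 := by
  obtain ⟨x, hx⟩ := nonempty_of_measure_ne_zero h.pos_measure.ne'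
  have := h.minor x hx Set.univ
  simpa using this

instance (h : SmallSet P π J β ν) : IsMarkovKernel (indicator h) := by
  classical
  refine ⟨fun x => ⟨?_⟩⟩
  rw [indicator, Kernel.piecewise_apply]
  split_ifs
  · simp only [Kernel.const_apply, Measure.coe_add, Measure.coe_smul, Pi.add_apply,
      Pi.smul_apply, measure_univ, smul_eq_mul, mul_one]
    rw [← ENNReal.ofReal_add h.pos.le (by linarith [h.le_one])]
    simp
  · simp

instance (h : SmallSet P π J β ν) : IsMarkovKernel (residual h) := by
  classical
  refine ⟨fun x => ⟨?_⟩⟩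
  change (if x ∈ J then
      if β = 1 then ν else (ENNReal.ofReal (1 - β))⁻¹ • (P x - ENNReal.ofReal β • ν)
      else P x) Set.univ = 1
  split_ifs with hx hb
  · simp
  · have hfin : IsFiniteMeasure (ENNReal.ofReal β • ν) :=
      ν.smul_finite ENNReal.ofReal_ne_top
    have hlt : 0 < 1 - β := by
      have := lt_of_le_of_ne h.le_one hb
      linarith
    rw [Measure.smul_apply, Measure.sub_apply MeasurableSet.univ (h.minor x hx),
      Measure.smul_apply, smul_eq_mul, smul_eq_mul, measure_univ, measure_univ, mul_one,
      ← ENNReal.ofReal_one, ← ENNReal.ofReal_sub _ h.pos.le]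
    rw [ENNReal.ofReal_one]
    exact ENNReal.inv_mul_cancel (by simpa using hlt) ENNReal.ofReal_ne_top
  · simp

/-- The law of `X n` given `(X (n - 1), Γ (n - 1))`: it is `ν` if `Γ (n - 1) = 1`, and
`Q(X (n - 1), ·)` if `Γ (n - 1) = 0`. The value `1` of `Γ` is `true`, and `0` is `false`. -/
noncomputable def move (h : SmallSet P π J β ν) : Kernel (S × Bool) S :=
  open Classical in
  Kernel.piecewise (s := Prod.snd ⁻¹' {true})
    (measurable_snd (measurableSet_singleton true))
    (Kernel.const _ ν) ((residual h).comap Prod.fst measurable_fst)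

instance (h : SmallSet P π J β ν) : IsMarkovKernel (move h) := by
  classical
  refine ⟨fun p => ⟨?_⟩⟩
  rw [move, Kernel.piecewise_apply]
  split_ifs <;> simp

/-- The transition kernel of the split chain `(X n, Γ n)` on `S × {0, 1}`: first `X` moves, then
`Γ` is drawn given the new `X`. -/
noncomputable def splitKernel (h : SmallSet P π J β ν) : Kernel (S × Bool) (S × Bool) :=
  move h ⊗ₖ Kernel.prodMkLeft (S × Bool) (indicator h)

instance (h : SmallSet P π J β ν) : IsMarkovKernel (splitKernel h) := by
  unfold splitKernel; infer_instance

/-- The law on path space of the split chain `(X n, Γ n)`, `n = 0, 1, 2, …`, with `X 0 ∼ μ`. -/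
noncomputable def splitChain (h : SmallSet P π J β ν) (μ : Measure S) :
    Measure (ℕ → S × Bool) :=
  Kernel.trajMeasure (X := fun _ => S × Bool) (μ ⊗ₘ indicator h) fun n =>
    (splitKernel h).comap (fun x => x ⟨n, Finset.mem_Iic.2 le_rfl⟩) (measurable_pi_apply _)

end Split

section Block

variable {S : Type*}

/-- The first regeneration time `τ₁ = T₁ = min {n ≥ 1 : Γ (n - 1) = 1}` (with `T₀ = 0`) of a path
of the split chain; it is `∞` if there is no regeneration. -/
noncomputable def regenTime (ω : ℕ → S × Bool) : ℕ∞ :=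
  ⨅ (n : ℕ) (_ : 1 ≤ n ∧ (ω (n - 1)).2 = true), (n : ℕ∞)

/-- The first block sum `Ξ₁(g) = ∑ g(X i)`, over `0 ≤ i < T₁`. -/
noncomputable def blockSum (g : S → ℝ) (ω : ℕ → S × Bool) : ℝ :=
  open Classical in
  ∑' i : ℕ, if (i : ℕ∞) < regenTime ω then g (ω i).1 else 0

end Block

section Constants

variable {S : Type*} [MeasurableSpace S] {P : Kernel S S} [IsMarkovKernel P] {π : Measure S}
  {J : Set S} {β : ℝ} {ν : Measure S} [IsProbabilityMeasure ν]

/-- `E τ₁`, for the chain started with `X 0 ∼ ν`. -/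
noncomputable def meanRegenTime (h : SmallSet P π J β ν) : ℝ≥0∞ :=
  ∫⁻ ω, (regenTime ω : ℝ≥0∞) ∂(splitChain h ν)

/-- `E τ₁²`, for the chain started with `X 0 ∼ ν`. -/
noncomputable def meanSqRegenTime (h : SmallSet P π J β ν) : ℝ≥0∞ :=
  ∫⁻ ω, (regenTime ω : ℝ≥0∞) ^ 2 ∂(splitChain h ν)

/-- The overshoot constant `n₀ = E τ₁² / E τ₁ - 1`. Since `τ₁ ≥ 1` the difference is not
truncated. -/
noncomputable def overshoot (h : SmallSet P π J β ν) : ℝ≥0∞ :=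
  meanSqRegenTime h / meanRegenTime h - 1

/-- The asymptotic variance `σ²_as(f) = E (Ξ₁(f - π(f)))² / E τ₁`, for the chain started with
`X 0 ∼ ν`. -/
noncomputable def asVar (h : SmallSet P π J β ν) (f : S → ℝ) : ℝ≥0∞ :=
  (∫⁻ ω, ENNReal.ofReal (blockSum (fun x => f x - ∫ y, f y ∂π) ω ^ 2) ∂(splitChain h ν))
    / meanRegenTime h

end Constants

end RegenSim

/-! Kill the split chain at its first regeneration. With `Γ` averaged out, what remains is the
sub-Markov operator R = P - β 1_J ⊗ ν (`killedOp`), and Σ_k R^k u (x) is the expected sum of u over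
a block started at x. Invariance reads π = πR + βπ(J)ν. Iterated, it gives Kac's formula π = βπ(J)
Σ_k νR^k (`eq_regenRate_smul_sum`), hence E τ₁ = 1/(βπ(J)). Expanding the square of a block sum and
applying Kac's formula to each gap between two times gives, for u ≥ 0, E(Ξ₁(u))²/E τ₁ = ∫ u (u + 2
Σ_{k≥1} R^k u) dπ (`lintegral_sq_tsum_survival`). The drift condition makes the affine function H =
V/(1-λ) + (K-λ-β)/(β(1-λ)) satisfy V + RH ≤ H (`Drift.add_killedOp_le`), so Σ_{k≥1} R^k V ≤ H - V.
Taking u = 1 ≤ V gives n₀ ≤ 2π(H - V); taking u = V ≥ |f̄| gives σ² ≤ π(V(V + 2(H - V))). These are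
the two bounds. -/

namespace RegenSim

set_option linter.unusedSectionVars false

/-! ### The operator of the chain killed at regeneration -/

section Killed

variable {S : Type*} [MeasurableSpace S] {P : Kernel S S} [IsMarkovKernel P] {π : Measure S}
  {J : Set S} {β : ℝ} {ν : Measure S} [IsProbabilityMeasure ν]

instance isFiniteMeasure_ofReal_smul (β : ℝ) (ν : Measure S) [IsProbabilityMeasure ν] :
    IsFiniteMeasure (ENNReal.ofReal β • ν) :=
  ν.smul_finite ENNReal.ofReal_ne_top

/-- The expected value of `G (x, Γ)` over the regeneration indicator `Γ` in state `x`. -/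
noncomputable def fiberMean (h : SmallSet P π J β ν) (G : S × Bool → ℝ≥0∞) (x : S) : ℝ≥0∞ :=
  ∫⁻ b, G (x, b) ∂(indicator h x)

/-- The sub-Markov kernel `P(x, ·) - β 1(x ∈ J) ν` of the chain killed at regeneration, acting on
functions. -/
noncomputable def killedOp (h : SmallSet P π J β ν) (g : S → ℝ≥0∞) (x : S) : ℝ≥0∞ :=
  fiberMean h (fun p => if p.2 = true then 0 else ∫⁻ y, g y ∂(residual h p.1)) x

/-- The transition operator of the split chain, killed at regeneration. -/
noncomputable def splitKilledOp (h : SmallSet P π J β ν) (G : S × Bool → ℝ≥0∞) (p : S × Bool) :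
    ℝ≥0∞ :=
  if p.2 = true then 0 else ∫⁻ q, G q ∂(splitKernel h p)

theorem fiberMean_eq (h : SmallSet P π J β ν) (G : S × Bool → ℝ≥0∞) (x : S) :
    fiberMean h G x = J.indicator (fun _ => ENNReal.ofReal β) x * G (x, true)
      + (1 - J.indicator (fun _ => ENNReal.ofReal β) x) * G (x, false) := by
  classical
  rw [fiberMean, indicator, Kernel.piecewise_apply]
  by_cases hx : x ∈ J
  · simp [hx, ENNReal.ofReal_sub _ h.pos.le]
  · simp [hx]

theorem killedOp_eq (h : SmallSet P π J β ν) (g : S → ℝ≥0∞) (x : S) :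
    killedOp h g x = (1 - J.indicator (fun _ => ENNReal.ofReal β) x)
      * ∫⁻ y, g y ∂(residual h x) := by
  rw [killedOp, fiberMean_eq]
  simp

/-- Splitting does not change the law of the next state: P = R + β 1_J ⊗ ν. The additive form avoids
subtraction in `ℝ≥0∞`. -/
theorem lintegral_eq_killedOp_add (h : SmallSet P π J β ν) (g : S → ℝ≥0∞) (x : S) :
    ∫⁻ y, g y ∂(P x) = killedOp h g x
      + J.indicator (fun _ => ENNReal.ofReal β * ∫⁻ y, g y ∂ν) x := by
  classical
  rw [killedOp_eq]
  have hres : residual h x = if x ∈ J then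
      if β = 1 then ν else (ENNReal.ofReal (1 - β))⁻¹ • (P x - ENNReal.ofReal β • ν)
      else P x := by
    rw [residual]; congr
  by_cases hx : x ∈ J
  · have hP : P x = P x - ENNReal.ofReal β • ν + ENNReal.ofReal β • ν :=
      (Measure.sub_add_cancel_of_le (h.minor x hx)).symm
    simp only [hx, Set.indicator_of_mem]
    -- If β = 1, minorization between two probability measures forces P(x, ·) = ν, and the killed
    -- term has the factor 1 - β = 0.
    by_cases hb : β = 1
    · have hle : ν ≤ P x := by simpa [hb] using h.minor x hx
      have : P x = ν := (Measure.eq_of_le_of_measure_univ_eq hle (by simp)).symm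
      simp [hb, this]
    · have hlt : 0 < 1 - β := by
        have := lt_of_le_of_ne h.le_one hb
        linarith
      rw [hres, if_pos hx, if_neg hb, lintegral_smul_measure, smul_eq_mul, ← ENNReal.ofReal_one,
        ← ENNReal.ofReal_sub _ h.pos.le, ← mul_assoc,
        ENNReal.mul_inv_cancel (by simpa using hlt) ENNReal.ofReal_ne_top, one_mul]
      conv_lhs => rw [hP]
      rw [lintegral_add_measure, lintegral_smul_measure, smul_eq_mul]
  · simp [hx, hres]

@[fun_prop]
theorem measurable_fiberMean (h : SmallSet P π J β ν) {G : S × Bool → ℝ≥0∞} (hG : Measurable G) :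
    Measurable (fiberMean h G) := by
  have : Measurable fun x => ∫⁻ b, G (x, b) ∂(indicator h x) := hG.lintegral_kernel_prod_right'
  exact this

@[fun_prop]
theorem measurable_killedOp (h : SmallSet P π J β ν) {g : S → ℝ≥0∞} (hg : Measurable g) :
    Measurable (killedOp h g) := by
  refine measurable_fiberMean h (Measurable.ite ?_ measurable_const ?_)
  · exact measurable_snd (measurableSet_singleton true)
  · exact hg.lintegral_kernel.comp measurable_fst

@[fun_prop]
theorem measurable_splitKilledOp (h : SmallSet P π J β ν) {G : S × Bool → ℝ≥0∞}
    (hG : Measurable G) : Measurable (splitKilledOp h G) :=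
  Measurable.ite (measurable_snd (measurableSet_singleton true)) measurable_const
    hG.lintegral_kernel

theorem measurable_iterate_killedOp (h : SmallSet P π J β ν) {g : S → ℝ≥0∞} (hg : Measurable g)
    (n : ℕ) : Measurable ((killedOp h)^[n] g) := by
  induction n with
  | zero => exact hg
  | succ n ih => rw [Function.iterate_succ_apply']; exact measurable_killedOp h ih

theorem measurable_iterate_splitKilledOp (h : SmallSet P π J β ν) {G : S × Bool → ℝ≥0∞}
    (hG : Measurable G) (n : ℕ) : Measurable ((splitKilledOp h)^[n] G) := by
  induction n with
  | zero => exact hG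
  | succ n ih => rw [Function.iterate_succ_apply']; exact measurable_splitKilledOp h ih

theorem killedOp_mono (h : SmallSet P π J β ν) {f g : S → ℝ≥0∞} (hfg : f ≤ g) :
    killedOp h f ≤ killedOp h g := fun x => by
  rw [killedOp_eq, killedOp_eq]
  gcongr with y
  exact hfg y

theorem iterate_killedOp_mono (h : SmallSet P π J β ν) {f g : S → ℝ≥0∞} (hfg : f ≤ g) (n : ℕ) :
    (killedOp h)^[n] f ≤ (killedOp h)^[n] g :=
  Monotone.iterate (f := killedOp h) (fun _ _ => killedOp_mono h) n hfg

theorem killedOp_sum (h : SmallSet P π J β ν) (g : ℕ → S → ℝ≥0∞) (hg : ∀ k, Measurable (g k))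
    (n : ℕ) (x : S) :
    killedOp h (fun y => ∑ k ∈ Finset.range n, g k y) x
      = ∑ k ∈ Finset.range n, killedOp h (g k) x := by
  simp_rw [killedOp_eq]
  rw [lintegral_finsetSum _ fun k _ => hg k, Finset.mul_sum]

theorem fiberMean_mul_left (h : SmallSet P π J β ν) (u : S → ℝ≥0∞) (G : S × Bool → ℝ≥0∞) :
    fiberMean h (fun p => u p.1 * G p) = fun x => u x * fiberMean h G x := by
  ext x
  simp only [fiberMean_eq]
  ring

/-- The new mark depends only on the new state, so averaging over the mark intertwines the killed
operators on `S × Bool` and on `S`. -/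
theorem fiberMean_splitKilledOp (h : SmallSet P π J β ν) {G : S × Bool → ℝ≥0∞}
    (hG : Measurable G) : fiberMean h (splitKilledOp h G) = killedOp h (fiberMean h G) := by
  classical
  ext x
  rw [fiberMean_eq, killedOp_eq]
  have : ∫⁻ q, G q ∂(splitKernel h (x, false)) = ∫⁻ y, fiberMean h G y ∂(residual h x) := by
    rw [splitKernel, Kernel.lintegral_compProd _ _ _ hG, move, Kernel.piecewise_apply]
    simp [fiberMean]
  simp [splitKilledOp, this]

theorem fiberMean_iterate_splitKilledOp (h : SmallSet P π J β ν) {G : S × Bool → ℝ≥0∞}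
    (hG : Measurable G) (n : ℕ) :
    fiberMean h ((splitKilledOp h)^[n] G) = (killedOp h)^[n] (fiberMean h G) := by
  induction n with
  | zero => rfl
  | succ n ih =>
    rw [Function.iterate_succ_apply', Function.iterate_succ_apply', ← ih,
      fiberMean_splitKilledOp h (measurable_iterate_splitKilledOp h hG n)]

theorem fiberMean_comp_fst (h : SmallSet P π J β ν) (u : S → ℝ≥0∞) :
    fiberMean h (fun p => u p.1) = u := by
  ext x
  simp only [fiberMean]
  rw [lintegral_const, measure_univ, mul_one]

end Killed

/-! ### Block sums as series weighted by survival indicators -/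

section Survival

variable {S : Type*}

/-- `survival n ω = 1` if there is no regeneration mark before time `n`, and `0` otherwise. -/
noncomputable def survival (n : ℕ) (ω : ℕ → S × Bool) : ℝ≥0∞ :=
  ∏ i ∈ Finset.range n, if (ω i).2 = true then 0 else 1

theorem survival_succ (n : ℕ) (ω : ℕ → S × Bool) :
    survival (n + 1) ω = survival n ω * if (ω n).2 = true then 0 else 1 :=
  Finset.prod_range_succ _ _

theorem survival_eq (n : ℕ) (ω : ℕ → S × Bool) [Decidable ((n : ℕ∞) < regenTime ω)] :
    survival n ω = if (n : ℕ∞) < regenTime ω then 1 else 0 := by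
  -- A mark at time i means regeneration at time i + 1, so `n < τ₁` concerns the marks at times 0,
  -- …, n - 1 only.
  have key : (n : ℕ∞) < regenTime ω ↔ ∀ i < n, (ω i).2 = false := by
    rw [← not_iff_not, not_lt, regenTime, iInf_subtype']
    constructor
    · intro hle
      by_contra! hall
      have : ((n + 1 : ℕ) : ℕ∞) ≤
          ⨅ m : {m : ℕ // 1 ≤ m ∧ (ω (m - 1)).2 = true}, ((m : ℕ) : ℕ∞) := by
        refine le_iInf fun m => ?_
        by_contra! hlt
        have hlt' : (m : ℕ) < n + 1 := by exact_mod_cast hlt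
        have h1 := m.2.1
        have := hall (m - 1) (by omega)
        simp [m.2.2] at this
      have h2 := this.trans hle
      have : n + 1 ≤ n := by exact_mod_cast h2
      omega
    · intro hex
      push Not at hex
      obtain ⟨i, hi, hb⟩ := hex
      refine (iInf_le _ ⟨i + 1, by omega, by simpa using hb⟩).trans ?_
      exact_mod_cast hi
  rw [survival]
  split_ifs with hlt
  · rw [key] at hlt
    exact Finset.prod_eq_one fun i hi => by simp [hlt i (Finset.mem_range.1 hi)]
  · rw [key] at hlt
    push Not at hlt
    obtain ⟨i, hi, hb⟩ := hlt
    exact Finset.prod_eq_zero (Finset.mem_range.2 hi) (by simpa using hb)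

theorem survival_dependsOn (n : ℕ) : DependsOn (survival (S := S) n) (Set.Iio n) := by
  intro ω ω' hω
  refine Finset.prod_congr rfl fun i hi => ?_
  rw [hω i (Finset.mem_range.1 hi)]

theorem toENNReal_regenTime (ω : ℕ → S × Bool) :
    (regenTime ω : ℝ≥0∞) = ∑' n, survival n ω := by
  classical
  simp_rw [survival_eq]
  induction regenTime ω using ENat.recTopCoe with
  | top => simp
  | coe m =>
    rw [tsum_eq_sum (s := Finset.range m)]
    · rw [Finset.sum_congr rfl (g := fun _ => 1)]
      · simp
      · intro i hi
        rw [if_pos]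
        exact_mod_cast Finset.mem_range.1 hi
    · intro i hi
      rw [if_neg]
      simpa using hi

/-- No summability is needed: a divergent real `tsum` is 0, which only helps the bound. -/
theorem ofReal_sq_blockSum_le (g : S → ℝ) (u : S → ℝ≥0∞) (hgu : ∀ x, ENNReal.ofReal |g x| ≤ u x)
    (ω : ℕ → S × Bool) :
    ENNReal.ofReal (blockSum g ω ^ 2) ≤ (∑' n, survival n ω * u (ω n).1) ^ 2 := by
  classical
  rw [← sq_abs, ENNReal.ofReal_pow (abs_nonneg _)]
  gcongr
  rw [← Real.norm_eq_abs, ofReal_norm, blockSum]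
  refine (enorm_tsum_le_tsum_enorm).trans (ENNReal.tsum_le_tsum fun n => ?_)
  rw [survival_eq]
  split_ifs
  · rw [one_mul, ← ofReal_norm, Real.norm_eq_abs]
    exact hgu _
  · simp

end Survival

/-! ### Markov property of the split chain on path space -/

section Chain

variable {S : Type*} [MeasurableSpace S] {P : Kernel S S} [IsMarkovKernel P] {π : Measure S}
  {J : Set S} {β : ℝ} {ν : Measure S} [IsProbabilityMeasure ν]

@[fun_prop]
theorem measurable_survival {S : Type*} [MeasurableSpace S] (n : ℕ) : Measurable (survival (S := S) n) := by
  refine Finset.measurable_prod _ fun i _ => ?_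
  exact Measurable.ite ((measurable_snd.comp (measurable_pi_apply i))
    (measurableSet_singleton true)) measurable_const measurable_const

instance (h : SmallSet P π J β ν) (μ : Measure S) [IsProbabilityMeasure μ] :
    IsProbabilityMeasure (splitChain h μ) := by
  unfold splitChain; infer_instance

theorem lintegral_splitChain_zero (h : SmallSet P π J β ν) (μ : Measure S)
    [IsProbabilityMeasure μ] {G : S × Bool → ℝ≥0∞} (hG : Measurable G) :
    ∫⁻ ω, G (ω 0) ∂(splitChain h μ) = ∫⁻ x, fiberMean h G x ∂μ := by
  have hG0 : Measurable fun ω : ℕ → S × Bool => G (ω 0) := hG.comp (measurable_pi_apply 0)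
  rw [splitChain, Kernel.trajMeasure, Measure.lintegral_bind (Kernel.aemeasurable _) hG0.aemeasurable]
  have key : ∀ x₀ : (Finset.Iic 0 → S × Bool),
      ∫⁻ ω, G (ω 0) ∂(Kernel.traj (X := fun _ => S × Bool) (fun n =>
        (splitKernel h).comap (fun x => x ⟨n, Finset.mem_Iic.2 le_rfl⟩) (measurable_pi_apply _))
        0 x₀) = G (x₀ ⟨0, Finset.mem_Iic.2 le_rfl⟩) := by
    intro x₀
    have hm : Measurable fun y : (Finset.Iic 0 → S × Bool) =>
      G (y ⟨0, Finset.mem_Iic.2 le_rfl⟩) := by fun_prop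
    have := lintegral_map (μ := Kernel.traj (X := fun _ => S × Bool) (fun n =>
        (splitKernel h).comap (fun x => x ⟨n, Finset.mem_Iic.2 le_rfl⟩) (measurable_pi_apply _))
        0 x₀) hm (Preorder.measurable_frestrictLe (X := fun _ => S × Bool) 0)
    rw [Kernel.traj_map_frestrictLe_apply, Kernel.partialTraj_self, Kernel.id_apply,
      lintegral_dirac' _ hm] at this
    exact this.symm
  simp_rw [key]
  rw [lintegral_map (by fun_prop) (by fun_prop), Measure.lintegral_compProd]
  · rfl
  · exact hG

theorem lintegral_splitChain_succ (h : SmallSet P π J β ν) (μ : Measure S)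
    [IsProbabilityMeasure μ] (n : ℕ) {Φ : (ℕ → S × Bool) → ℝ≥0∞} (hΦ : Measurable Φ)
    (hdep : DependsOn Φ (Set.Iic n)) {G : S × Bool → ℝ≥0∞} (hG : Measurable G) :
    ∫⁻ ω, Φ ω * G (ω (n + 1)) ∂(splitChain h μ)
      = ∫⁻ ω, Φ ω * ∫⁻ q, G q ∂(splitKernel h (ω n)) ∂(splitChain h μ) := by
  -- A history up to time n is extended to a path by freezing it after n; `hdep` makes the choice of
  -- extension immaterial.
  let F : (Finset.Iic n → S × Bool) → ℝ≥0∞ :=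
    fun y => Φ fun j => y ⟨min j n, Finset.mem_Iic.2 (min_le_right _ _)⟩
  have hF : Measurable F := hΦ.comp (measurable_pi_lambda _ fun j => measurable_pi_apply _)
  have hFΦ : ∀ ω, F (Preorder.frestrictLe (π := fun _ => S × Bool) n ω) = Φ ω := fun ω =>
    hdep fun j hj => by simp [min_eq_left (Set.mem_Iic.1 hj)]
  have hmeas : Measurable fun z : (Finset.Iic n → S × Bool) × (S × Bool) => F z.1 * G z.2 := by
    fun_prop
  have key := congrArg (fun m => ∫⁻ z, F z.1 * G z.2 ∂m)
    (Kernel.map_frestrictLe_trajMeasure_compProd_eq_map_trajMeasure (X := fun _ => S × Bool)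
      (μ₀ := μ ⊗ₘ indicator h) (κ := fun n =>
        (splitKernel h).comap (fun x => x ⟨n, Finset.mem_Iic.2 le_rfl⟩) (measurable_pi_apply _))
      (a := n))
  rw [lintegral_map hmeas (by fun_prop), Measure.lintegral_compProd hmeas,
    lintegral_map (by fun_prop) (by fun_prop)] at key
  simp only [hFΦ] at key
  rw [splitChain, ← key]
  refine lintegral_congr fun ω => ?_
  rw [lintegral_const_mul _ hG]
  rfl

/-- Condition on the path up to the last time but one: the last survival factor is exactly the
killing in `splitKilledOp`. Repeat k times. -/
theorem lintegral_survival_mul_add (h : SmallSet P π J β ν) (μ : Measure S)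
    [IsProbabilityMeasure μ] (i k : ℕ) {u : S → ℝ≥0∞} (hu : Measurable u)
    {G : S × Bool → ℝ≥0∞} (hG : Measurable G) :
    ∫⁻ ω, survival (i + k) ω * u (ω i).1 * G (ω (i + k)) ∂(splitChain h μ)
      = ∫⁻ ω, survival i ω * (u (ω i).1 * (splitKilledOp h)^[k] G (ω i)) ∂(splitChain h μ) := by
  induction k generalizing G with
  | zero => simp [mul_assoc]
  | succ k ih =>
    rw [Function.iterate_succ_apply, ← ih (measurable_splitKilledOp h hG), ← add_assoc,
      lintegral_splitChain_succ h μ (i + k) (by fun_prop) _ hG]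
    · refine lintegral_congr fun ω => ?_
      rw [survival_succ, splitKilledOp]
      split_ifs <;> simp
    · intro ω ω' hω
      simp only
      rw [survival_dependsOn (i + k + 1) fun j hj => hω j (Nat.lt_succ_iff.1 hj),
        hω i (Set.mem_Iic.2 (Nat.le_add_right i k))]

/-- Peel back from i + k to i, then from i to 0; averaging over the mark at time 0 turns
`splitKilledOp` into `killedOp`. -/
theorem lintegral_survival_mul_mul (h : SmallSet P π J β ν) (μ : Measure S)
    [IsProbabilityMeasure μ] (i k : ℕ) {u v : S → ℝ≥0∞} (hu : Measurable u) (hv : Measurable v) :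
    ∫⁻ ω, survival (i + k) ω * u (ω i).1 * v (ω (i + k)).1 ∂(splitChain h μ)
      = ∫⁻ x, (killedOp h)^[i] (fun y => u y * (killedOp h)^[k] v y) x ∂μ := by
  have hv' : Measurable fun p : S × Bool => v p.1 := by fun_prop
  have hG : Measurable fun p : S × Bool =>
      u p.1 * (splitKilledOp h)^[k] (fun p : S × Bool => v p.1) p :=
    (hu.comp measurable_fst).mul (measurable_iterate_splitKilledOp h hv' k)
  have h1 := lintegral_survival_mul_add h μ i k hu hv'
  have h2 := lintegral_survival_mul_add h μ 0 i (u := fun _ => 1) measurable_const hG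
  simp only [zero_add, mul_one, one_mul] at h2
  rw [h1, h2]
  simp only [survival, Finset.range_zero, Finset.prod_empty, one_mul]
  rw [lintegral_splitChain_zero h μ (measurable_iterate_splitKilledOp h hG i),
    fiberMean_iterate_splitKilledOp h hG, fiberMean_mul_left,
    fiberMean_iterate_splitKilledOp h hv', fiberMean_comp_fst]

theorem lintegral_survival_mul (h : SmallSet P π J β ν) (μ : Measure S)
    [IsProbabilityMeasure μ] (i : ℕ) {u : S → ℝ≥0∞} (hu : Measurable u) :
    ∫⁻ ω, survival i ω * u (ω i).1 ∂(splitChain h μ) = ∫⁻ x, (killedOp h)^[i] u x ∂μ := by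
  simpa using lintegral_survival_mul_mul h μ i 0 hu (v := fun _ => 1) measurable_const

end Chain

/-- Diagonal plus twice the upper triangle, the latter indexed by the gap k + 1. -/
theorem sq_tsum_eq (a : ℕ → ℝ≥0∞) :
    (∑' i, a i) ^ 2 = ∑' i, (a i * a i + 2 * ∑' k, a i * a (i + (k + 1))) := by
  classical
  have htail : ∀ (i : ℕ) (f : ℕ → ℝ≥0∞),
      ∑' j, (if i < j then f j else 0) = ∑' k, f (i + (k + 1)) := by
    intro i f
    have hinj : Function.Injective fun k : ℕ => i + (k + 1) := fun k l hkl => by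
      simpa using hkl
    rw [← hinj.tsum_eq]
    · exact tsum_congr fun k => if_pos (by omega)
    · intro j hj
      have : i < j := by
        by_contra hlt
        simp [hlt] at hj
      exact ⟨j - i - 1, by simp only; omega⟩
  have hsplit : ∀ i, ∑' j, a i * a j = a i * a i + (∑' j, if j < i then a i * a j else 0)
      + ∑' j, if i < j then a i * a j else 0 := by
    intro i
    rw [← tsum_ite_eq i (fun j => a i * a j), ← ENNReal.tsum_add, ← ENNReal.tsum_add]
    refine tsum_congr fun j => ?_
    rcases lt_trichotomy j i with hj | hj | hj
    · simp [hj, hj.ne, hj.not_gt]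
    · simp [hj]
    · simp [hj, hj.ne', hj.not_gt]
  have hcomm : ∑' i, ∑' j, (if j < i then a i * a j else 0)
      = ∑' i, ∑' j, if i < j then a i * a j else 0 := by
    rw [ENNReal.tsum_comm]
    simp_rw [mul_comm]
  calc (∑' i, a i) ^ 2 = ∑' i, ∑' j, a i * a j := by
        rw [sq, ← ENNReal.tsum_mul_right]
        simp_rw [ENNReal.tsum_mul_left]
    _ = _ := by
        simp_rw [hsplit, ENNReal.tsum_add]
        rw [hcomm, add_assoc, ← two_mul, ← ENNReal.tsum_mul_left]
        simp_rw [htail]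

/-! ### Kac's formula and the second moment of a block -/

section Occupation

variable {S : Type*} [MeasurableSpace S] {P : Kernel S S} [IsMarkovKernel P] {π : Measure S}
  [IsProbabilityMeasure π]
  {J : Set S} {β : ℝ} {ν : Measure S} [IsProbabilityMeasure ν]

/-- The partial sums satisfy S_{n+1} = u + R S_n, so S_n ≤ H gives S_{n+1} ≤ u + RH ≤ H. -/
theorem sum_iterate_killedOp_le (h : SmallSet P π J β ν) {u H : S → ℝ≥0∞} (hu : Measurable u)
    (hH : ∀ x, u x + killedOp h H x ≤ H x) (n : ℕ) (x : S) :
    ∑ k ∈ Finset.range n, (killedOp h)^[k] u x ≤ H x := by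
  induction n generalizing x with
  | zero => simp
  | succ n ih =>
    rw [Finset.sum_range_succ', add_comm]
    refine le_trans ?_ (hH x)
    simp only [Function.iterate_succ_apply', Function.iterate_zero, id]
    rw [← killedOp_sum h _ fun k => measurable_iterate_killedOp h hu k]
    gcongr
    exact killedOp_mono h ih x

theorem tsum_iterate_killedOp_le (h : SmallSet P π J β ν) {u H : S → ℝ≥0∞} (hu : Measurable u)
    (hH : ∀ x, u x + killedOp h H x ≤ H x) (x : S) :
    ∑' k, (killedOp h)^[k] u x ≤ H x :=
  ENNReal.tsum_le_of_sum_range_le fun n => sum_iterate_killedOp_le h hu hH n x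

/-- The probability, for the stationary chain, of a regeneration in a given step. -/
noncomputable def regenRate (_h : SmallSet P π J β ν) : ℝ≥0∞ := ENNReal.ofReal β * π J

theorem regenRate_ne_zero (h : SmallSet P π J β ν) : regenRate h ≠ 0 :=
  mul_ne_zero (by simpa using h.pos) h.pos_measure.ne'

theorem regenRate_ne_top (h : SmallSet P π J β ν) : regenRate h ≠ ⊤ :=
  ENNReal.mul_ne_top ENNReal.ofReal_ne_top (measure_ne_top π J)

theorem lintegral_killedOp_add (h : SmallSet P π J β ν) (hπ : Kernel.Invariant P π)
    {g : S → ℝ≥0∞} (hg : Measurable g) :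
    ∫⁻ x, g x ∂π = ∫⁻ x, killedOp h g x ∂π + regenRate h * ∫⁻ x, g x ∂ν := by
  conv_lhs => rw [← hπ.def, Measure.lintegral_bind (Kernel.aemeasurable _) hg.aemeasurable]
  simp_rw [lintegral_eq_killedOp_add h g]
  rw [lintegral_add_left (measurable_killedOp h hg), lintegral_indicator h.measurableSet,
    setLIntegral_const, regenRate]
  ring

theorem lintegral_iterate_killedOp_add (h : SmallSet P π J β ν) (hπ : Kernel.Invariant P π)
    {g : S → ℝ≥0∞} (hg : Measurable g) (n : ℕ) :
    ∫⁻ x, g x ∂π = ∫⁻ x, (killedOp h)^[n] g x ∂π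
      + regenRate h * ∑ k ∈ Finset.range n, ∫⁻ x, (killedOp h)^[k] g x ∂ν := by
  induction n with
  | zero => simp
  | succ n ih =>
    rw [ih, lintegral_killedOp_add h hπ (measurable_iterate_killedOp h hg n),
      Finset.sum_range_succ, Function.iterate_succ_apply']
    ring

/-- The law of `X n` for the split chain started from `μ`, on the event of no regeneration
before time `n`. -/
noncomputable def survivingLaw (h : SmallSet P π J β ν) (μ : Measure S) (n : ℕ) : Measure S :=
  ((splitChain h μ).withDensity (survival n)).map fun ω => (ω n).1

theorem lintegral_survivingLaw (h : SmallSet P π J β ν) (μ : Measure S) [IsProbabilityMeasure μ]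
    (n : ℕ) {g : S → ℝ≥0∞} (hg : Measurable g) :
    ∫⁻ x, g x ∂(survivingLaw h μ n) = ∫⁻ x, (killedOp h)^[n] g x ∂μ := by
  rw [survivingLaw, lintegral_map hg (by fun_prop), lintegral_withDensity_eq_lintegral_mul _
    (measurable_survival n) (by fun_prop), ← lintegral_survival_mul h μ n hg]
  rfl

/-- Kac's formula: the stationary distribution is the normalized occupation measure of a block. -/
theorem eq_regenRate_smul_sum (h : SmallSet P π J β ν) (hπ : Kernel.Invariant P π)
    (hfin : ∀ x, ∑' k, (killedOp h)^[k] (fun _ => 1) x ≠ ⊤) :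
    π = regenRate h • Measure.sum (survivingLaw h ν) := by
  ext A hA
  have hm : Measurable (A.indicator (1 : S → ℝ≥0∞)) := measurable_one.indicator hA
  -- The remainder πR^n(A) vanishes by dominated convergence: R^n 1_A ≤ R^n 1 ≤ 1, and R^n 1 (x) is
  -- the general term of a convergent series.
  have h0 : Filter.Tendsto
      (fun n => ∫⁻ x, (killedOp h)^[n] (A.indicator 1) x ∂π) Filter.atTop (nhds 0) := by
    have hle : ∀ n x, (killedOp h)^[n] (A.indicator 1) x ≤ (killedOp h)^[n] (fun _ => 1) x :=
      fun n x => iterate_killedOp_mono h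
        (Set.indicator_le fun _ _ => le_rfl : A.indicator (1 : S → ℝ≥0∞) ≤ fun _ => 1) n x
    have hone : ∀ n, (killedOp h)^[n] (fun _ => 1) ≤ fun _ => 1 := by
      intro n
      induction n with
      | zero => exact le_rfl
      | succ n ih =>
        rw [Function.iterate_succ_apply']
        refine (killedOp_mono h ih).trans fun x => ?_
        rw [killedOp_eq, lintegral_const, measure_univ]
        simp
    have hlim := tendsto_lintegral_of_dominated_convergence (μ := π) (fun _ => 1)
      (f := fun _ => 0) (F := fun n => (killedOp h)^[n] (A.indicator 1))
      (measurable_iterate_killedOp h hm)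
      (fun n => Filter.Eventually.of_forall fun x => (hle n x).trans (hone n x))
      (by simp)
      (Filter.Eventually.of_forall fun x =>
        tendsto_of_tendsto_of_tendsto_of_le_of_le tendsto_const_nhds
          (ENNReal.tendsto_atTop_zero_of_tsum_ne_top (hfin x)) (fun _ => zero_le)
          fun n => hle n x)
    simpa using hlim
  have hsum := h0.add (ENNReal.Tendsto.const_mul (a := regenRate h)
    ((ENNReal.summable (f := fun k =>
      ∫⁻ x, (killedOp h)^[k] (A.indicator 1) x ∂ν)).hasSum.tendsto_sum_nat)
    (Or.inr (regenRate_ne_top h)))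
  simp_rw [← lintegral_iterate_killedOp_add h hπ hm] at hsum
  have heq := tendsto_nhds_unique tendsto_const_nhds hsum
  rw [lintegral_indicator_one hA, zero_add] at heq
  rw [heq, Measure.smul_apply, Measure.sum_apply _ hA, smul_eq_mul]
  congr 1
  refine tsum_congr fun k => ?_
  rw [← lintegral_survivingLaw h ν k hm, lintegral_indicator_one hA]

/-- Kac's formula as an identity of measures covers unbounded g, for which the domination by 1 is
unavailable. -/
theorem lintegral_eq_regenRate_mul_tsum (h : SmallSet P π J β ν) (hπ : Kernel.Invariant P π)
    (hfin : ∀ x, ∑' k, (killedOp h)^[k] (fun _ => 1) x ≠ ⊤) {g : S → ℝ≥0∞} (hg : Measurable g) :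
    ∫⁻ x, g x ∂π = regenRate h * ∑' k, ∫⁻ x, (killedOp h)^[k] g x ∂ν := by
  conv_lhs => rw [eq_regenRate_smul_sum h hπ hfin]
  rw [lintegral_smul_measure, lintegral_sum_measure, smul_eq_mul]
  simp_rw [lintegral_survivingLaw h ν _ hg]

theorem meanRegenTime_eq_inv (h : SmallSet P π J β ν) (hπ : Kernel.Invariant P π)
    (hfin : ∀ x, ∑' k, (killedOp h)^[k] (fun _ => 1) x ≠ ⊤) :
    meanRegenTime h = (regenRate h)⁻¹ := by
  have h1 := lintegral_eq_regenRate_mul_tsum h hπ hfin (g := fun _ => 1) measurable_const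
  simp_rw [← lintegral_survival_mul h ν _ (measurable_const (a := (1 : ℝ≥0∞))), mul_one] at h1
  rw [← lintegral_tsum fun n => (measurable_survival n).aemeasurable] at h1
  simp_rw [← toENNReal_regenTime] at h1
  rw [lintegral_const, measure_univ, mul_one] at h1
  rw [meanRegenTime]
  exact ENNReal.eq_inv_of_mul_eq_one_left (by rw [mul_comm]; exact h1.symm)

/-- The second moment of the sum over a block, through the stationary distribution. -/
theorem lintegral_sq_tsum_survival (h : SmallSet P π J β ν) (hπ : Kernel.Invariant P π)
    (hfin : ∀ x, ∑' k, (killedOp h)^[k] (fun _ => 1) x ≠ ⊤) {u : S → ℝ≥0∞} (hu : Measurable u) :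
    (∫⁻ ω, (∑' n, survival n ω * u (ω n).1) ^ 2 ∂(splitChain h ν)) / meanRegenTime h
      = ∫⁻ x, u x * (u x + 2 * ∑' k, (killedOp h)^[k + 1] u x) ∂π := by
  classical
  have hit : ∀ k, Measurable ((killedOp h)^[k] u) := measurable_iterate_killedOp h hu
  have hprod : ∀ (ω : ℕ → S × Bool) (i k : ℕ),
      survival i ω * u (ω i).1 * (survival (i + k) ω * u (ω (i + k)).1)
        = survival (i + k) ω * u (ω i).1 * u (ω (i + k)).1 := by
    intro ω i k
    have : survival i ω * survival (i + k) ω = survival (i + k) ω := by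
      rw [survival_eq, survival_eq]
      split_ifs with h1 h2 h2
      · simp
      · simp
      · exact absurd (lt_of_le_of_lt (by exact_mod_cast Nat.le_add_right i k) h2) h1
      · simp
    rw [mul_mul_mul_comm, this, mul_assoc]
  have hdiag : ∀ ω : ℕ → S × Bool, ∀ i,
      survival i ω * u (ω i).1 * (survival i ω * u (ω i).1)
        = survival i ω * u (ω i).1 * u (ω i).1 := fun ω i => hprod ω i 0
  simp_rw [sq_tsum_eq, hdiag, hprod]
  rw [meanRegenTime_eq_inv h hπ hfin, ENNReal.div_eq_inv_mul, inv_inv,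
    lintegral_tsum fun i => Measurable.aemeasurable (by fun_prop)]
  have hterm : ∀ i, ∫⁻ ω, (survival i ω * u (ω i).1 * u (ω i).1
      + 2 * ∑' k, survival (i + (k + 1)) ω * u (ω i).1 * u (ω (i + (k + 1))).1)
        ∂(splitChain h ν)
      = ∫⁻ x, (killedOp h)^[i] (fun y => u y * u y) x ∂ν
        + 2 * ∑' k, ∫⁻ x, (killedOp h)^[i] (fun y => u y * (killedOp h)^[k + 1] u y) x ∂ν := by
    intro i
    rw [lintegral_add_left (by fun_prop), lintegral_const_mul _ (by fun_prop),
      lintegral_tsum fun k => Measurable.aemeasurable (by fun_prop)]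
    congr 1
    · exact lintegral_survival_mul_mul h ν i 0 hu hu
    · simp_rw [lintegral_survival_mul_mul h ν i _ hu hu]
  simp_rw [hterm]
  -- With the gap k outermost, the sum over the earlier time i is an occupation sum, which Kac's
  -- formula turns into an integral against π.
  rw [ENNReal.tsum_add, ENNReal.tsum_mul_left, ENNReal.tsum_comm, mul_add, mul_left_comm]
  have hd : regenRate h * ∑' i, ∫⁻ x, (killedOp h)^[i] (fun y => u y * u y) x ∂ν
      = ∫⁻ x, u x * u x ∂π := (lintegral_eq_regenRate_mul_tsum h hπ hfin (hu.mul hu)).symm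
  rw [hd, ← ENNReal.tsum_mul_left]
  have hk : ∀ k, regenRate h * ∑' i, ∫⁻ x, (killedOp h)^[i]
      (fun y => u y * (killedOp h)^[k + 1] u y) x ∂ν
        = ∫⁻ x, u x * (killedOp h)^[k + 1] u x ∂π := fun k =>
    (lintegral_eq_regenRate_mul_tsum h hπ hfin (hu.mul (hit (k + 1)))).symm
  have hcross : ∀ k, Measurable fun x => u x * (killedOp h)^[k + 1] u x := fun k =>
    hu.mul (hit (k + 1))
  simp_rw [hk]
  rw [← lintegral_tsum fun k => (hcross k).aemeasurable]
  simp_rw [ENNReal.tsum_mul_left]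
  have hmeas : Measurable fun x => u x * ∑' k, (killedOp h)^[k + 1] u x :=
    hu.mul (Measurable.tsum fun k => hit (k + 1))
  rw [← lintegral_const_mul _ hmeas, ← lintegral_add_left (by fun_prop)]
  refine lintegral_congr fun x => ?_
  ring

end Occupation

/-! ### Drift estimates and the two bounds -/

section DriftBound

variable {S : Type*} [MeasurableSpace S]

theorem integrable_of_lintegral_ofReal_ne_top {μ : Measure S} {V : S → ℝ} (hV : Measurable V)
    (hV1 : ∀ x, 1 ≤ V x) (hfin : ∫⁻ x, ENNReal.ofReal (V x) ∂μ ≠ ⊤) : Integrable V μ :=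
  (lintegral_ofReal_ne_top_iff_integrable hV.aestronglyMeasurable
    (Filter.Eventually.of_forall fun x => by have := hV1 x; simp only [Pi.zero_apply]; linarith)).1
    hfin

variable {P : Kernel S S} [IsMarkovKernel P] {π : Measure S} [IsProbabilityMeasure π]
  {J : Set S} {β : ℝ} {ν : Measure S} [IsProbabilityMeasure ν] {V : S → ℝ} {lam K : ℝ}

theorem Drift.integrable (hdrift : Drift P J V lam K) (hV : Measurable V) (hV1 : ∀ x, 1 ≤ V x)
    (x : S) : Integrable V (P x) := by
  refine integrable_of_lintegral_ofReal_ne_top hV hV1 ?_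
  by_cases hx : x ∈ J
  · exact ne_top_of_le_ne_top ENNReal.ofReal_ne_top (hdrift.on x hx)
  · exact ne_top_of_le_ne_top ENNReal.ofReal_ne_top (hdrift.off x hx)

/-- At any point x of `J`, β ν(V) ≤ PV(x) ≤ K. -/
theorem Drift.integrable_minorant (hdrift : Drift P J V lam K) (h : SmallSet P π J β ν)
    (hV : Measurable V) (hV1 : ∀ x, 1 ≤ V x) : Integrable V ν := by
  obtain ⟨x, hx⟩ := nonempty_of_measure_ne_zero h.pos_measure.ne'
  refine integrable_of_lintegral_ofReal_ne_top hV hV1 fun htop => ?_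
  have h1 : ENNReal.ofReal β * ∫⁻ y, ENNReal.ofReal (V y) ∂ν ≤ ENNReal.ofReal K := by
    rw [← smul_eq_mul, ← lintegral_smul_measure]
    exact (lintegral_mono' (h.minor x hx) le_rfl).trans (hdrift.on x hx)
  rw [htop, ENNReal.mul_top (by simpa using h.pos)] at h1
  exact ENNReal.ofReal_ne_top (top_le_iff.1 h1)

theorem one_le_integral {μ : Measure S} [IsProbabilityMeasure μ] (hV1 : ∀ x, 1 ≤ V x)
    (hint : Integrable V μ) : 1 ≤ ∫ x, V x ∂μ := by
  simpa using integral_mono (integrable_const (1 : ℝ)) hint hV1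

theorem integral_le_of_lintegral_le {μ : Measure S} [IsProbabilityMeasure μ]
    (hV1 : ∀ x, 1 ≤ V x) (hint : Integrable V μ) {r : ℝ}
    (hle : ∫⁻ x, ENNReal.ofReal (V x) ∂μ ≤ ENNReal.ofReal r) : ∫ x, V x ∂μ ≤ r := by
  rw [← ofReal_integral_eq_lintegral_ofReal hint
    (Filter.Eventually.of_forall fun x => zero_le_one.trans (hV1 x))] at hle
  exact (ENNReal.ofReal_le_ofReal_iff'.1 hle).resolve_right
    (by have := one_le_integral hV1 hint; linarith)

theorem Drift.one_le (hdrift : Drift P J V lam K) (h : SmallSet P π J β ν)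
    (hV : Measurable V) (hV1 : ∀ x, 1 ≤ V x) : 1 ≤ K := by
  obtain ⟨x, hx⟩ := nonempty_of_measure_ne_zero h.pos_measure.ne'
  have hint := hdrift.integrable hV hV1 x
  exact (one_le_integral hV1 hint).trans (integral_le_of_lintegral_le hV1 hint (hdrift.on x hx))

/-- The bound on the expected sum of `V` over a block started in a state with `V = v`. -/
noncomputable def blockBound (β lam K v : ℝ) : ℝ :=
  v / (1 - lam) + (K - lam - β) / (β * (1 - lam))

/-- The constant K - λ - β may be negative; v ≥ 1 and K ≥ 1 compensate, so that `ENNReal.ofReal`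
truncates nothing. -/
theorem blockBound_pos (hβ : 0 < β) (hlam1 : lam < 1) (hK : 1 ≤ K) {v : ℝ} (hv : 1 ≤ v) :
    0 < blockBound β lam K v := by
  have h1 : 0 < 1 - lam := by linarith
  have : blockBound β lam K v = (β * (v - 1) + (K - 1) + (1 - lam)) / (β * (1 - lam)) := by
    rw [blockBound]
    field_simp
    ring
  rw [this]
  have : 0 ≤ β * (v - 1) := mul_nonneg hβ.le (by linarith)
  exact div_pos (by linarith) (mul_pos hβ h1)

theorem integrable_blockBound {μ : Measure S} [IsProbabilityMeasure μ] (hint : Integrable V μ)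
    (β lam K : ℝ) : Integrable (fun x => blockBound β lam K (V x)) μ :=
  (hint.div_const _).add (integrable_const _)

theorem lintegral_blockBound {μ : Measure S} [IsProbabilityMeasure μ] (hV1 : ∀ x, 1 ≤ V x)
    (hint : Integrable V μ) (hβ : 0 < β) (hlam1 : lam < 1) (hK : 1 ≤ K) :
    ∫⁻ x, ENNReal.ofReal (blockBound β lam K (V x)) ∂μ
      = ENNReal.ofReal (blockBound β lam K (∫ x, V x ∂μ)) := by
  rw [← ofReal_integral_eq_lintegral_ofReal
    (integrable_blockBound hint β lam K)
    (Filter.Eventually.of_forall fun x => (blockBound_pos hβ hlam1 hK (hV1 x)).le)]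
  congr 1
  simp only [blockBound]
  rw [integral_add (hint.div_const _) (integrable_const _), integral_div]
  simp

/-- The bound `blockBound` is a supersolution of the Poisson equation of the killed chain. -/
theorem Drift.add_killedOp_le (hdrift : Drift P J V lam K) (h : SmallSet P π J β ν)
    (hV : Measurable V) (hV1 : ∀ x, 1 ≤ V x) (hlam0 : 0 ≤ lam) (hlam1 : lam < 1) (x : S) :
    ENNReal.ofReal (V x) + killedOp h (fun y => ENNReal.ofReal (blockBound β lam K (V y))) x
      ≤ ENNReal.ofReal (blockBound β lam K (V x)) := by
  have hK := hdrift.one_le h hV hV1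
  have hint := hdrift.integrable hV hV1 x
  have hintν := hdrift.integrable_minorant h hV hV1
  have hP := lintegral_blockBound (β := β) hV1 hint h.pos hlam1 hK
  have hν := lintegral_blockBound (β := β) hV1 hintν h.pos hlam1 hK
  have hPpos := blockBound_pos h.pos hlam1 hK (one_le_integral hV1 hint)
  have hνpos := blockBound_pos h.pos hlam1 hK (one_le_integral hV1 hintν)
  have hν1 := one_le_integral hV1 hintν
  have hx1 := hV1 x
  have hl : 0 < 1 - lam := by linarith
  rw [lintegral_eq_killedOp_add h] at hP
  by_cases hx : x ∈ J
  · rw [Set.indicator_of_mem hx, hν, ← ENNReal.ofReal_mul h.pos.le] at hP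
    have hPK := integral_le_of_lintegral_le hV1 hint (hdrift.on x hx)
    -- Adding β ν(H) to both sides completes RH to PH, which is explicit because H is affine in V.
    refine (ENNReal.add_le_add_iff_right (a := ENNReal.ofReal
      (β * blockBound β lam K (∫ x, V x ∂ν))) ENNReal.ofReal_ne_top).1 ?_
    rw [add_assoc, hP, ← ENNReal.ofReal_add (by linarith) hPpos.le,
      ← ENNReal.ofReal_add (blockBound_pos h.pos hlam1 hK hx1).le (mul_pos h.pos hνpos).le]
    refine ENNReal.ofReal_le_ofReal ?_
    have hβ := h.pos
    set p := ∫ y, V y ∂(P x)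
    set n := ∫ y, V y ∂ν
    -- The constant term of H is chosen so that the slack splits into three nonnegative pieces, from
    -- V ≥ 1, PV ≤ K and ν(V) ≥ 1.
    have : blockBound β lam K (V x) + β * blockBound β lam K n - (V x + blockBound β lam K p)
        = (lam * (V x - 1) + (K - p) + β * (n - 1)) / (1 - lam) := by
      simp only [blockBound]
      field_simp
      ring
    have h2 : 0 ≤ (lam * (V x - 1) + (K - p) + β * (n - 1)) / (1 - lam) := by
      refine div_nonneg ?_ hl.le
      have h3 := mul_nonneg hlam0 (sub_nonneg.2 hx1)
      have h4 := mul_nonneg hβ.le (sub_nonneg.2 hν1)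
      linarith
    linarith
  · rw [Set.indicator_of_notMem hx, add_zero] at hP
    have hPK := integral_le_of_lintegral_le hV1 hint (hdrift.off x hx)
    rw [hP, ← ENNReal.ofReal_add (by linarith) hPpos.le]
    refine ENNReal.ofReal_le_ofReal ?_
    set p := ∫ y, V y ∂(P x)
    -- Off `J` the constant cancels and the slope 1/(1-λ) alone does the work.
    have : blockBound β lam K (V x) - (V x + blockBound β lam K p)
        = (lam * V x - p) / (1 - lam) := by
      simp only [blockBound]
      field_simp
      ring
    have := div_nonneg (sub_nonneg.2 hPK) hl.le
    linarith

theorem Drift.tsum_le (hdrift : Drift P J V lam K) (h : SmallSet P π J β ν)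
    (hV : Measurable V) (hV1 : ∀ x, 1 ≤ V x) (hlam0 : 0 ≤ lam) (hlam1 : lam < 1) (x : S) :
    ∑' k, (killedOp h)^[k] (fun y => ENNReal.ofReal (V y)) x
      ≤ ENNReal.ofReal (blockBound β lam K (V x)) :=
  tsum_iterate_killedOp_le h hV.ennreal_ofReal
    (hdrift.add_killedOp_le h hV hV1 hlam0 hlam1) x

theorem one_le_ofReal (hV1 : ∀ x, 1 ≤ V x) :
    (fun _ => 1 : S → ℝ≥0∞) ≤ fun y => ENNReal.ofReal (V y) := fun y => by
  simpa using ENNReal.ofReal_le_ofReal (hV1 y)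

theorem Drift.tsum_one_ne_top (hdrift : Drift P J V lam K) (h : SmallSet P π J β ν)
    (hV : Measurable V) (hV1 : ∀ x, 1 ≤ V x) (hlam0 : 0 ≤ lam) (hlam1 : lam < 1) (x : S) :
    ∑' k, (killedOp h)^[k] (fun _ => 1) x ≠ ⊤ :=
  ne_top_of_le_ne_top ENNReal.ofReal_ne_top <|
    (ENNReal.tsum_le_tsum fun k => iterate_killedOp_mono h (one_le_ofReal hV1) k x).trans
      (hdrift.tsum_le h hV hV1 hlam0 hlam1 x)

theorem Drift.tsum_succ_le (hdrift : Drift P J V lam K) (h : SmallSet P π J β ν)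
    (hV : Measurable V) (hV1 : ∀ x, 1 ≤ V x) (hlam0 : 0 ≤ lam) (hlam1 : lam < 1) (x : S) :
    ∑' k, (killedOp h)^[k + 1] (fun y => ENNReal.ofReal (V y)) x
      ≤ ENNReal.ofReal (blockBound β lam K (V x) - V x) := by
  have h1 := hdrift.tsum_le h hV hV1 hlam0 hlam1 x
  rw [tsum_eq_zero_add' ENNReal.summable] at h1
  rw [ENNReal.ofReal_sub _ (zero_le_one.trans (hV1 x))]
  exact ENNReal.le_sub_of_add_le_left ENNReal.ofReal_ne_top h1

theorem Drift.le_blockBound (hdrift : Drift P J V lam K) (h : SmallSet P π J β ν)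
    (hV : Measurable V) (hV1 : ∀ x, 1 ≤ V x) (hlam0 : 0 ≤ lam) (hlam1 : lam < 1) (x : S) :
    V x ≤ blockBound β lam K (V x) := by
  have h1 := hdrift.add_killedOp_le h hV hV1 hlam0 hlam1 x
  exact (ENNReal.ofReal_le_ofReal_iff
    (blockBound_pos h.pos hlam1 (hdrift.one_le h hV hV1) (hV1 x)).le).1
    (le_self_add.trans h1)

/-- By Kac's formula π(V) ≤ βπ(J) ν(H), which is finite since ν(V) is. -/
theorem Drift.integrable_stationary (hdrift : Drift P J V lam K) (h : SmallSet P π J β ν)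
    (hπ : Kernel.Invariant P π)
    (hV : Measurable V) (hV1 : ∀ x, 1 ≤ V x) (hlam0 : 0 ≤ lam) (hlam1 : lam < 1) :
    Integrable V π := by
  refine integrable_of_lintegral_ofReal_ne_top hV hV1 ?_
  have hfin := hdrift.tsum_one_ne_top h hV hV1 hlam0 hlam1
  rw [lintegral_eq_regenRate_mul_tsum h hπ hfin hV.ennreal_ofReal,
    ← lintegral_tsum fun k => (measurable_iterate_killedOp h hV.ennreal_ofReal k).aemeasurable]
  refine ENNReal.mul_ne_top (regenRate_ne_top h) (ne_top_of_le_ne_top ?_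
    (lintegral_mono (hdrift.tsum_le h hV hV1 hlam0 hlam1)))
  rw [lintegral_blockBound hV1 (hdrift.integrable_minorant h hV hV1) h.pos hlam1
    (hdrift.one_le h hV hV1)]
  exact ENNReal.ofReal_ne_top

theorem coe_ofReal_le {a : ℝ≥0∞} {r : ℝ} (hr : 0 ≤ r) (ha : a ≤ ENNReal.ofReal r) :
    (a : EReal) ≤ (r : EReal) := by
  refine (EReal.coe_ennreal_le_coe_ennreal_iff.2 ha).trans_eq ?_
  rw [EReal.coe_ennreal_ofReal, max_eq_left hr]

theorem Drift.overshoot_le (hdrift : Drift P J V lam K) (h : SmallSet P π J β ν)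
    (hπ : Kernel.Invariant P π)
    (hV : Measurable V) (hV1 : ∀ x, 1 ≤ V x) (hlam0 : 0 ≤ lam) (hlam1 : lam < 1) :
    ((overshoot h : ℝ≥0∞) : EReal) ≤
      ((2 * ((lam * (∫ x, V x ∂π) - lam) / (1 - lam)
        + (K - lam) / (β * (1 - lam)) - 1) : ℝ) : EReal) := by
  have hfin := hdrift.tsum_one_ne_top h hV hV1 hlam0 hlam1
  have hint := hdrift.integrable_stationary h hπ hV hV1 hlam0 hlam1
  have hle := hdrift.le_blockBound h hV hV1 hlam0 hlam1
  have hB := integrable_blockBound hint β lam K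
  have hBV : Integrable (fun x => blockBound β lam K (V x) - V x) π := hB.sub hint
  have heq : 2 * ((lam * (∫ x, V x ∂π) - lam) / (1 - lam) + (K - lam) / (β * (1 - lam)) - 1)
      = 2 * ∫ x, (blockBound β lam K (V x) - V x) ∂π := by
    have h1 : 1 - lam ≠ 0 := by linarith
    have h2 := h.pos.ne'
    rw [integral_sub hB hint]
    simp only [blockBound]
    rw [integral_add (hint.div_const _) (integrable_const _), integral_div, integral_const,
      probReal_univ, one_smul]
    field_simp
    ring
  have hnn : 0 ≤ ∫ x, (blockBound β lam K (V x) - V x) ∂π :=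
    integral_nonneg fun x => sub_nonneg.2 (hle x)
  rw [heq]
  refine coe_ofReal_le (by positivity) ?_
  -- With u = 1 the diagonal contributes exactly 1, which cancels the -1 in n₀.
  have h2 := lintegral_sq_tsum_survival h hπ hfin (u := fun _ => 1) measurable_const
  simp only [mul_one, one_mul, ← toENNReal_regenTime] at h2
  have hm : Measurable fun x => ∑' k, (killedOp h)^[k + 1] (fun _ => 1) x :=
    Measurable.tsum fun k => measurable_iterate_killedOp h measurable_const (k + 1)
  rw [overshoot, meanSqRegenTime, h2, lintegral_add_left measurable_const, lintegral_const,
    measure_univ, mul_one, ENNReal.add_sub_cancel_left ENNReal.one_ne_top,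
    lintegral_const_mul _ hm, ENNReal.ofReal_mul zero_le_two, ENNReal.ofReal_ofNat,
    ofReal_integral_eq_lintegral_ofReal hBV
      (Filter.Eventually.of_forall fun x => sub_nonneg.2 (hle x))]
  gcongr with x
  exact (ENNReal.tsum_le_tsum fun k =>
    iterate_killedOp_mono h (one_le_ofReal hV1) (k + 1) x).trans
      (hdrift.tsum_succ_le h hV hV1 hlam0 hlam1 x)

theorem Drift.asVar_le (hdrift : Drift P J V lam K) (h : SmallSet P π J β ν)
    (hπ : Kernel.Invariant P π)
    (hV : Measurable V) (hV1 : ∀ x, 1 ≤ V x) (hlam0 : 0 ≤ lam) (hlam1 : lam < 1)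
    {f : S → ℝ} (hf : ∀ x, |f x - ∫ y, f y ∂π| ≤ V x) :
    ((asVar h f : ℝ≥0∞) : EReal) ≤
      (((1 + lam) / (1 - lam) : ℝ) : EReal)
          * ((∫⁻ x, ENNReal.ofReal (V x ^ 2) ∂π : ℝ≥0∞) : EReal)
        + ((2 * ((K - lam - β) / (β * (1 - lam))) * ∫ x, V x ∂π : ℝ) : EReal) := by
  have hfin := hdrift.tsum_one_ne_top h hV hV1 hlam0 hlam1
  have hint := hdrift.integrable_stationary h hπ hV hV1 hlam0 hlam1
  have hle := hdrift.le_blockBound h hV hV1 hlam0 hlam1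
  have hl : 0 < 1 - lam := by linarith
  -- The coefficient of π(V²) is positive and the other summand is real, so an infinite π(V²) makes
  -- the right side +∞.
  by_cases hV2 : ∫⁻ x, ENNReal.ofReal (V x ^ 2) ∂π = ⊤
  · rw [hV2, EReal.coe_ennreal_top, EReal.coe_mul_top_of_pos (div_pos (by linarith) hl),
      EReal.top_add_coe]
    exact le_top
  have hsq : Integrable (fun x => V x ^ 2) π :=
    (lintegral_ofReal_ne_top_iff_integrable (hV.pow_const 2).aestronglyMeasurable
      (Filter.Eventually.of_forall fun x => sq_nonneg (V x))).1 hV2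
  have hexp : ∀ x, V x * (V x + 2 * (blockBound β lam K (V x) - V x))
      = (1 + lam) / (1 - lam) * V x ^ 2 + 2 * ((K - lam - β) / (β * (1 - lam))) * V x := by
    intro x
    have h1 : 1 - lam ≠ 0 := hl.ne'
    have h2 := h.pos.ne'
    rw [blockBound]
    field_simp
    ring
  have hnn : ∀ x, 0 ≤ V x * (V x + 2 * (blockBound β lam K (V x) - V x)) := by
    intro x
    have h1 := hV1 x
    have h2 := hle x
    exact mul_nonneg (by linarith) (by linarith)
  have hI : Integrable (fun x => V x * (V x + 2 * (blockBound β lam K (V x) - V x))) π := by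
    simp_rw [hexp]
    exact (hsq.const_mul _).add (hint.const_mul _)
  have hval : ∫ x, V x * (V x + 2 * (blockBound β lam K (V x) - V x)) ∂π
      = (1 + lam) / (1 - lam) * (∫ x, V x ^ 2 ∂π)
        + 2 * ((K - lam - β) / (β * (1 - lam))) * ∫ x, V x ∂π := by
    simp_rw [hexp]
    rw [integral_add (hsq.const_mul _) (hint.const_mul _), integral_const_mul,
      integral_const_mul]
  rw [← ofReal_integral_eq_lintegral_ofReal hsq
    (Filter.Eventually.of_forall fun x => sq_nonneg (V x)), EReal.coe_ennreal_ofReal,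
    max_eq_left (integral_nonneg fun x => sq_nonneg (V x)), ← EReal.coe_mul, ← EReal.coe_add,
    ← hval]
  refine coe_ofReal_le (integral_nonneg hnn) ?_
  -- Only |f̄| ≤ V enters; cancellation within a block is not exploited.
  have hblock := fun ω => ofReal_sq_blockSum_le (fun x => f x - ∫ y, f y ∂π)
    (fun x => ENNReal.ofReal (V x)) (fun x => ENNReal.ofReal_le_ofReal (hf x)) ω
  rw [asVar]
  refine (ENNReal.div_le_div_right (lintegral_mono hblock) _).trans ?_
  rw [lintegral_sq_tsum_survival h hπ hfin hV.ennreal_ofReal,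
    ofReal_integral_eq_lintegral_ofReal hI (Filter.Eventually.of_forall hnn)]
  refine lintegral_mono fun x => ?_
  have h1 := hV1 x
  have h2 := hle x
  rw [ENNReal.ofReal_mul (by linarith), ENNReal.ofReal_add (by linarith) (by linarith),
    ENNReal.ofReal_mul zero_le_two, ENNReal.ofReal_ofNat]
  gcongr
  exact hdrift.tsum_succ_le h hV hV1 hlam0 hlam1 x

end DriftBound

end RegenSim

theorem theorem2 {S : Type*} [TopologicalSpace S] [PolishSpace S] [MeasurableSpace S]
    [BorelSpace S] (P : Kernel S S) [IsMarkovKernel P]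
    (π : Measure S) [IsProbabilityMeasure π] (hπ : Kernel.Invariant P π)
    (J : Set S) (β : ℝ) (ν : Measure S) [IsProbabilityMeasure ν]
    (h : RegenSim.SmallSet P π J β ν)
    (V : S → ℝ) (hV : Measurable V) (hV1 : ∀ x, 1 ≤ V x)
    (lam K : ℝ) (hlam0 : 0 ≤ lam) (hlam1 : lam < 1)
    (hdrift : RegenSim.Drift P J V lam K) :
    Integrable V π ∧ RegenSim.meanRegenTime h ≠ ⊤ ∧
    ((RegenSim.overshoot h : ℝ≥0∞) : EReal) ≤
      ((2 * ((lam * (∫ x, V x ∂π) - lam) / (1 - lam)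
        + (K - lam) / (β * (1 - lam)) - 1) : ℝ) : EReal) ∧
    ∀ f : S → ℝ, Measurable f → Integrable f π →
      (∀ x, |f x - ∫ y, f y ∂π| ≤ V x) →
      ((RegenSim.asVar h f : ℝ≥0∞) : EReal) ≤
        (((1 + lam) / (1 - lam) : ℝ) : EReal)
            * ((∫⁻ x, ENNReal.ofReal (V x ^ 2) ∂π : ℝ≥0∞) : EReal)
          + ((2 * ((K - lam - β) / (β * (1 - lam))) * ∫ x, V x ∂π : ℝ) : EReal) := by
  have hint := hdrift.integrable_stationary h hπ hV hV1 hlam0 hlam1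
  refine ⟨hint, ?_, hdrift.overshoot_le h hπ hV hV1 hlam0 hlam1, fun f _ _ hf =>
    hdrift.asVar_le h hπ hV hV1 hlam0 hlam1 hf⟩
  rw [RegenSim.meanRegenTime_eq_inv h hπ (hdrift.tsum_one_ne_top h hV hV1 hlam0 hlam1)]
  exact ENNReal.inv_ne_top.2 (RegenSim.regenRate_ne_zero h)
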